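/- Let $A>1$. For $d\ge 1$ let $\mathcal F_d(A)$ be the set of probability densities on $\mathbb R^d$ with respect to Lebesgue measure that are bounded by $A$ (that is, measurable $f:\mathbb R^d\to[0,A]$ with $\int f=1$). For densities $f,g$ let $P_f$ be the distribution of density $f$, and let $K(f|g)=\int f\log(f/g)$ if $P_f\ll P_g$ and $K(f|g)=+\infty$ otherwise. An estimator $\hat f_n$ based on a sample $X_1,\dots,X_n$ is a map that sends each sample to a probability density on $\mathbb R^d$, jointly measurable in the sample and the point of evaluation; $\mathbb E_f$ is the expectation when $X_1,\dots,X_n$ are i.i.d. of density $f$. For $f_1,\dots,f_M$ define the aggregate with exponential weights (progressive mixture) $$\tilde f_n=\sum_{j=1}^M\tilde w_j^{(n)}f_j,\qquad \tilde w_j^{(n)}=\frac1{n+1}\sum_{k=0}^n w_j^{(k)},\qquad w_j^{(k)}=\frac{f_j(X_1)\cdots f_j(X_k)}{\sum_{l=1}^M f_l(X_1)\cdots f_l(X_k)},\qquad w_j^{(0)}=\frac1M,$$ with $w_j^{(k)}=1/M$ if the denominator vanishes. **Theorem.** $\frac{\log M}{n}$ is an optimal rate of aggregation of $M$ functions in $(\mathcal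 F_d(A),\mathcal F_d(A))$ with respect to the Kullback–Leibler loss, and the progressive mixture is an optimal aggregation procedure. That is, there are constants $C,c>0$ depending only on $A$ such that for all integers $d\ge1$, $M\ge2$ and $n\ge1$ with $\log M\le 16(\min(1,A-1))^2\,n$: 1. for all $f_1,\dots,f_M\in\mathcal F_d(A)$ there is an estimator with values in $\mathcal F_d(A)$, namely the progressive mixture $\tilde f_n$, such that $$\sup_{f\in\mathcal F_d(A)}\Big[\mathbb E_f K(f|\tilde f_n)-\min_{j=1,\dots,M}K(f|f_j)\Big]\le C\,\frac{\log M}{n};$$ 2. there are $f_1,\dots,f_M\in\mathcal F_d(A)$ (which may depend on $M$, $n$ and $d$) such that for every estimator $\hat f_n$ $$\sup_{f\in\mathcal F_d(A)}\Big[\mathbb E_f K(f|\hat f_n)-\min_{j=1,\dots,M}K(f|f_j)\Big]\ge c\,\frac{\log M}{n}.$$ In both suprema, densities $f$ with $\min_j K(f|f_j)=+\infty$ are disregarded. -/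

import Mathlib

open MeasureTheory
open scoped ENNReal

namespace DensityAggregation

noncomputable section

/-- `f` is a probability density with respect to `ν`. -/
structure IsDensity {X : Type*} [MeasurableSpace X] (ν : Measure X) (f : X → ℝ) : Prop where
  measurable : Measurable f
  nonneg : ∀ x, 0 ≤ f x
  lintegral_eq_one : ∫⁻ x, ENNReal.ofReal (f x) ∂ν = 1

/-- The set of the probability densities with respect to `ν` that are bounded by `A`. -/
def densitiesBoundedBy {X : Type*} [MeasurableSpace X] (ν : Measure X) (A : ℝ) :
    Set (X → ℝ) :=
  {f | IsDensity ν f ∧ ∀ x, f x ≤ A}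

/-- The distribution `P_f` of density `f` with respect to `ν`. -/
def law {X : Type*} [MeasurableSpace X] (ν : Measure X) (f : X → ℝ) : Measure X :=
  ν.withDensity (fun x => ENNReal.ofReal (f x))

/-- The Kullback–Leibler loss `K(f|g)`, with values in `[0, ∞]`. -/
def klLoss {X : Type*} [MeasurableSpace X] (ν : Measure X) (f g : X → ℝ) : ℝ≥0∞ :=
  InformationTheory.klDiv (law ν f) (law ν g)

/-- A (density) estimator based on a sample of size `n`: a map that sends every sample to a
density, measurable jointly in the sample and the point of evaluation. -/
structure IsEstimator {X : Type*} [MeasurableSpace X] (ν : Measure X) (n : ℕ)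
    (fhat : (Fin n → X) → X → ℝ) : Prop where
  measurable : Measurable (fun p : (Fin n → X) × X => fhat p.1 p.2)
  isDensity : ∀ x, IsDensity ν (fhat x)

/-- The risk `E_f [K(f|fhat)]`, the sample consisting of `n` i.i.d. observations of density `f`. -/
def klRisk {X : Type*} [MeasurableSpace X] (ν : Measure X) {n : ℕ}
    (fhat : (Fin n → X) → X → ℝ) (f : X → ℝ) : ℝ≥0∞ :=
  ∫⁻ x, klLoss ν f (fhat x) ∂(Measure.pi (fun _ : Fin n => law ν f))

/-- The excess risk `E_f [K(f|fhat)] - min_j K(f|f_j)`. It is `⊥` in `EReal` if the minimum is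
infinite, so such an `f` plays no role in the suprema below. -/
def excessRisk {X : Type*} [MeasurableSpace X] (ν : Measure X) {M n : ℕ}
    (fs : Fin M → X → ℝ) (fhat : (Fin n → X) → X → ℝ) (f : X → ℝ) : EReal :=
  ((klRisk ν fhat f : ℝ≥0∞) : EReal) - ((⨅ j, klLoss ν f (fs j) : ℝ≥0∞) : EReal)

/-- The estimator `fhat` takes its values in `F₀` (where the loss is considered), and its worst
excess risk over `F` with respect to `fs` is at most `r`. -/
def AttainsUpperBound {X : Type*} [MeasurableSpace X] (ν : Measure X) (F₀ F : Set (X → ℝ))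
    {M n : ℕ} (fs : Fin M → X → ℝ) (fhat : (Fin n → X) → X → ℝ) (r : ℝ) : Prop :=
  IsEstimator ν n fhat ∧ (∀ x, fhat x ∈ F₀) ∧
    ⨆ f ∈ F, excessRisk ν fs fhat f ≤ (r : EReal)

/-- The lower bound in the definition of an optimal rate of aggregation, with constant `c`, for
all numbers `M ≥ 2` of functions and all sample sizes `n ≥ 1` such that `range M n`. -/
def LowerBound {X : Type*} [MeasurableSpace X] (ν : Measure X) (F₀ F : Set (X → ℝ))
    (range : ℕ → ℕ → Prop) (ψ : ℕ → ℕ → ℝ) (c : ℝ) : Prop :=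
  ∀ M n : ℕ, 2 ≤ M → 1 ≤ n → range M n →
    ∃ fs : Fin M → X → ℝ, (∀ j, fs j ∈ F₀) ∧
      ∀ fhat : (Fin n → X) → X → ℝ, IsEstimator ν n fhat →
        ((c * ψ M n : ℝ) : EReal) ≤ ⨆ f ∈ F, excessRisk ν fs fhat f

/-- `ψ M n` is an optimal rate of aggregation of `M` functions in `(F₀, F)` with respect to the
Kullback–Leibler loss, in the given range of `(M, n)`, with constants `C` and `c`. -/
def IsOptimalRate {X : Type*} [MeasurableSpace X] (ν : Measure X) (F₀ F : Set (X → ℝ))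
    (range : ℕ → ℕ → Prop) (ψ : ℕ → ℕ → ℝ) (C c : ℝ) : Prop :=
  (∀ M : ℕ, 2 ≤ M → ∀ fs : Fin M → X → ℝ, (∀ j, fs j ∈ F₀) →
    ∃ ftilde : ∀ n : ℕ, (Fin n → X) → X → ℝ,
      ∀ n : ℕ, 1 ≤ n → range M n →
        AttainsUpperBound ν F₀ F fs (ftilde n) (C * ψ M n)) ∧
  LowerBound ν F₀ F range ψ c

/-- The aggregation procedure `agg` is optimal with respect to the Kullback–Leibler loss: it
attains the upper bound `C * ψ M n`, and the matching lower bound `c * ψ M n` holds. -/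
def IsOptimalProcedure {X : Type*} [MeasurableSpace X] (ν : Measure X) (F₀ F : Set (X → ℝ))
    (range : ℕ → ℕ → Prop) (ψ : ℕ → ℕ → ℝ) (C c : ℝ)
    (agg : ∀ M n : ℕ, (Fin M → X → ℝ) → (Fin n → X) → X → ℝ) : Prop :=
  (∀ M : ℕ, 2 ≤ M → ∀ fs : Fin M → X → ℝ, (∀ j, fs j ∈ F₀) →
    ∀ n : ℕ, 1 ≤ n → range M n →
      AttainsUpperBound ν F₀ F fs (agg M n fs) (C * ψ M n)) ∧
  LowerBound ν F₀ F range ψ c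

/-- The likelihood `g(X_1) ⋯ g(X_k)` of `g` at the first `k` observations. -/
def likelihood {X : Type*} {n : ℕ} (g : X → ℝ) (x : Fin n → X) (k : ℕ) : ℝ :=
  ∏ i : Fin n with i.val < k, g (x i)

/-- The weight `w_j^{(k)}` of `f_j` after `k` observations, `k = 0, …, n`; it is `1 / M` for
`k = 0`, and also if all the likelihoods vanish. -/
def weight {X : Type*} {M n : ℕ} (fs : Fin M → X → ℝ) (x : Fin n → X) (k : ℕ)
    (j : Fin M) : ℝ :=
  if ∑ l, likelihood (fs l) x k = 0 then 1 / (M : ℝ)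
  else likelihood (fs j) x k / ∑ l, likelihood (fs l) x k

/-- The averaged weight `(n + 1)⁻¹ ∑_{k=0}^n w_j^{(k)}`. -/
def averagedWeight {X : Type*} {M n : ℕ} (fs : Fin M → X → ℝ) (x : Fin n → X)
    (j : Fin M) : ℝ :=
  ((n : ℝ) + 1)⁻¹ * ∑ k ∈ Finset.range (n + 1), weight fs x k j

/-- The aggregate with exponential weights (progressive mixture). -/
def progressiveMixture {X : Type*} (M n : ℕ) (fs : Fin M → X → ℝ) (x : Fin n → X) : X → ℝ :=
  fun y => ∑ j, averagedWeight fs x j * fs j y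

end

end DensityAggregation

namespace DensityAggregation

noncomputable section

open InformationTheory

/-! Upper bound. Let `w` be the share of `f_j` in the total likelihood of the first `k` observations
and `m` the mixture of the `f_l` with these shares. A new observation `y` turns `w` into `w f_j(y) /
m(y)`, so under `f` the quantity `-log w` changes on average by `∫ f log (m / f_j) = K(f|f_j) -
K(f|m)`. Telescoping from `-log (1 / M)` bounds the sum of the first `n` mixture risks together with
the expected final potential, and `w f_j ≤ m` pays for one more mixture out of that potential. Hence
the `n + 1` mixture risks add up to at most `log M + (n + 1) K(f|f_j)`; convexity of `K(f|·)` then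
gives the progressive mixture an excess of at most `log M / (n + 1)`
(`klRisk_progressiveMixture_le`).

Lower bound. All `f_j` equal `1 - δ` on a common cube and each puts its remaining mass `δ` on a cube
of its own. With probability `(1 - δ) ^ n` the sample lies in the common cube and says nothing about
`j`; any density must then divide its mass among `M` candidates, at an average loss of at least `δ
log M` (`ofReal_mul_log_le_sum_klRisk` in spirit, formally `ofReal_le_sum_klRisk`). Take `δ = 1 / (n
+ 1)`.

All losses live in `[0, ∞]`: the terms `b - a` make the integrand nonnegative, so no integrability
is needed, and negative terms are moved across the inequality. -/

/-- The integrand `a log (a / b) + b - a` of the Kullback–Leibler divergence, with values in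
`[0, ∞]`. -/
def klPoint (a b : ℝ) : ℝ≥0∞ :=
  if b = 0 then (if a = 0 then 0 else ⊤) else ENNReal.ofReal (a * Real.log (a / b) + b - a)

lemma measurable_klPoint : Measurable (fun p : ℝ × ℝ => klPoint p.1 p.2) := by
  unfold klPoint
  refine Measurable.ite (measurable_snd (measurableSet_singleton 0)) ?_ (by fun_prop)
  exact Measurable.ite (measurable_fst (measurableSet_singleton 0)) (by fun_prop) (by fun_prop)

lemma klPoint_zero_left (b : ℝ) : klPoint 0 b = ENNReal.ofReal b := by
  by_cases hb : b = 0 <;> simp [klPoint, hb]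

lemma klPoint_zero_right {a : ℝ} (ha : a ≠ 0) : klPoint a 0 = ⊤ := by simp [klPoint, ha]

lemma klPoint_of_ne_zero {a b : ℝ} (hb : b ≠ 0) :
    klPoint a b = ENNReal.ofReal (a * Real.log (a / b) + b - a) := by simp [klPoint, hb]

lemma mul_log_div_add_sub_nonneg {a b : ℝ} (ha : 0 ≤ a) (hb : 0 < b) :
    0 ≤ a * Real.log (a / b) + b - a := by
  have h := mul_nonneg hb.le (klFun_nonneg (div_nonneg ha hb.le))
  rw [klFun_apply] at h
  have : b * (a / b * Real.log (a / b) + 1 - a / b) = a * Real.log (a / b) + b - a := by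
    field_simp
  linarith

lemma ofReal_mul_klFun_div {a b : ℝ} (hb : 0 < b) :
    ENNReal.ofReal b * ENNReal.ofReal (klFun (a / b)) = klPoint a b := by
  rw [klPoint_of_ne_zero hb.ne', ← ENNReal.ofReal_mul hb.le, klFun_apply]
  congr 1
  field_simp

/-! ### The Kullback–Leibler loss as an integral of `klPoint`. -/

section Law

variable {X : Type*} [MeasurableSpace X] {ν : Measure X} {f g : X → ℝ}

lemma IsDensity.isProbabilityMeasure_law (hf : IsDensity ν f) :
    IsProbabilityMeasure (law ν f) :=
  ⟨by simpa [law] using hf.lintegral_eq_one⟩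

lemma IsDensity.lintegral_law (hf : IsDensity ν f) {h : X → ℝ≥0∞} (hh : Measurable h) :
    ∫⁻ x, h x ∂(law ν f) = ∫⁻ x, ENNReal.ofReal (f x) * h x ∂ν := by
  rw [law, lintegral_withDensity_eq_lintegral_mul _ hf.measurable.ennreal_ofReal hh]
  rfl

lemma IsDensity.law_absolutelyContinuous_iff (hf : IsDensity ν f) (hg : IsDensity ν g) :
    law ν f ≪ law ν g ↔ ∀ᵐ x ∂ν, g x = 0 → f x = 0 := by
  have hgm := hg.measurable.ennreal_ofReal
  have hs : MeasurableSet {x | g x = 0} := hg.measurable (measurableSet_singleton 0)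
  constructor
  · intro h
    have h0 : law ν g {x | g x = 0} = 0 := by
      rw [law, withDensity_apply _ hs, setLIntegral_eq_zero_iff hs hgm]
      exact ae_of_all _ fun x (hx : g x = 0) => by simp [hx]
    have h1 := h h0
    rw [law, withDensity_apply _ hs, setLIntegral_eq_zero_iff hs
      hf.measurable.ennreal_ofReal] at h1
    filter_upwards [h1] with x hx hgx
    exact le_antisymm (ENNReal.ofReal_eq_zero.1 (hx hgx)) (hf.nonneg x)
  · intro h
    refine Measure.AbsolutelyContinuous.mk fun s hs h0 => ?_
    rw [law, withDensity_apply _ hs, setLIntegral_eq_zero_iff hs hgm] at h0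
    rw [law, withDensity_apply _ hs, setLIntegral_eq_zero_iff hs hf.measurable.ennreal_ofReal]
    filter_upwards [h, h0] with x hx hx0 hxs
    simp [hx (le_antisymm (ENNReal.ofReal_eq_zero.1 (hx0 hxs)) (hg.nonneg x))]

lemma IsDensity.rnDeriv_law (hf : IsDensity ν f) (hg : IsDensity ν g)
    (hfg : law ν f ≪ law ν g) :
    (law ν f).rnDeriv (law ν g) =ᵐ[law ν g] fun x => ENNReal.ofReal (f x / g x) := by
  have := hg.isProbabilityMeasure_law
  have hm : Measurable fun x => ENNReal.ofReal (f x / g x) :=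
    (hf.measurable.div hg.measurable).ennreal_ofReal
  have h : law ν f = (law ν g).withDensity fun x => ENNReal.ofReal (f x / g x) := by
    rw [law, law, ← withDensity_mul _ hg.measurable.ennreal_ofReal hm]
    refine withDensity_congr_ae ?_
    filter_upwards [(hf.law_absolutelyContinuous_iff hg).1 hfg] with x hx
    by_cases hgx : g x = 0
    · simp [hx hgx]
    · rw [Pi.mul_apply, ← ENNReal.ofReal_mul (hg.nonneg x), mul_div_cancel₀ _ hgx]
  conv_lhs => rw [h]
  exact Measure.rnDeriv_withDensity _ hm

/-- Under absolute continuity this is a change of measure in `∫ klFun (dP_f/dP_g) dP_g`. Otherwise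
`klPoint` is `⊤` on a set of positive measure, and both sides are infinite. -/
theorem IsDensity.klLoss_eq_lintegral (hf : IsDensity ν f) (hg : IsDensity ν g) :
    klLoss ν f g = ∫⁻ x, klPoint (f x) (g x) ∂ν := by
  have := hf.isProbabilityMeasure_law
  have := hg.isProbabilityMeasure_law
  have hm : Measurable fun x => klPoint (f x) (g x) :=
    measurable_klPoint.comp (hf.measurable.prodMk hg.measurable)
  by_cases hfg : law ν f ≪ law ν g
  · have hk : Measurable fun x => ENNReal.ofReal (klFun (f x / g x)) :=
      (measurable_klFun.comp (hf.measurable.div hg.measurable)).ennreal_ofReal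
    rw [klLoss, klDiv_eq_lintegral_klFun_of_ac hfg]
    calc _ = ∫⁻ x, ENNReal.ofReal (klFun (f x / g x)) ∂(law ν g) := by
          refine lintegral_congr_ae ?_
          filter_upwards [hf.rnDeriv_law hg hfg] with x hx
          rw [hx, ENNReal.toReal_ofReal (div_nonneg (hf.nonneg x) (hg.nonneg x))]
      _ = ∫⁻ x, ENNReal.ofReal (g x) * ENNReal.ofReal (klFun (f x / g x)) ∂ν :=
          hg.lintegral_law hk
      _ = _ := by
          refine lintegral_congr_ae ?_
          filter_upwards [(hf.law_absolutelyContinuous_iff hg).1 hfg] with x hx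
          rcases (hg.nonneg x).eq_or_lt with h0 | h0
          · simp [← h0, hx h0.symm, klPoint]
          · exact ofReal_mul_klFun_div h0
  · rw [klLoss, klDiv_of_not_ac hfg]
    by_contra hne
    refine hfg ((hf.law_absolutelyContinuous_iff hg).2 ?_)
    filter_upwards [ae_lt_top hm (Ne.symm hne)] with x hx hgx
    by_contra hfx
    rw [hgx, klPoint_zero_right hfx] at hx
    exact lt_irrefl _ hx

lemma klLoss_self (hf : IsDensity ν f) : klLoss ν f f = 0 := by
  have := hf.isProbabilityMeasure_law
  exact klDiv_self _

lemma IsEstimator.measurable_klLoss [SFinite ν] {n : ℕ} {fhat : (Fin n → X) → X → ℝ}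
    (hf : IsDensity ν f) (hfhat : IsEstimator ν n fhat) :
    Measurable fun x => klLoss ν f (fhat x) := by
  simp_rw [fun x => hf.klLoss_eq_lintegral (hfhat.isDensity x)]
  exact Measurable.lintegral_prod_right'
    (f := fun p : (Fin n → X) × X => klPoint (f p.2) (fhat p.1 p.2))
    (measurable_klPoint.comp ((hf.measurable.comp measurable_snd).prodMk hfhat.measurable))

end Law

/-! ### Convexity of the loss in its second argument. -/

section Convexity

/-- The tangent to `-a log` at `c`, that is `log t ≤ t - 1` at `t = b / c`, with the linear terms
distributed so that nothing is subtracted. -/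
lemma klPoint_tangent {a b c : ℝ} (ha : 0 ≤ a) (hb : 0 ≤ b) (hc : 0 < c) :
    klPoint a c + ENNReal.ofReal (a + b) ≤ klPoint a b + ENNReal.ofReal (a * b / c + c) := by
  rcases ha.eq_or_lt with rfl | ha
  · simp only [klPoint_zero_left]
    rw [← ENNReal.ofReal_add, ← ENNReal.ofReal_add] <;> try positivity
    exact ENNReal.ofReal_le_ofReal (by simp; linarith)
  rcases hb.eq_or_lt with rfl | hb
  · simp [klPoint_zero_right ha.ne']
  rw [klPoint_of_ne_zero hb.ne', klPoint_of_ne_zero hc.ne',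
    ← ENNReal.ofReal_add (mul_log_div_add_sub_nonneg ha.le hc) (by positivity),
    ← ENNReal.ofReal_add (mul_log_div_add_sub_nonneg ha.le hb) (by positivity)]
  refine ENNReal.ofReal_le_ofReal ?_
  have h := mul_le_mul_of_nonneg_left (Real.log_le_sub_one_of_pos (div_pos hb hc)) ha.le
  rw [Real.log_div ha.ne' hc.ne', Real.log_div ha.ne' hb.ne']
  rw [Real.log_div hb.ne' hc.ne', mul_sub, mul_sub, mul_one, ← mul_div_assoc] at h
  linarith [mul_sub a (Real.log a) (Real.log b), mul_sub a (Real.log a) (Real.log c)]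

/-- Jensen's inequality: average the tangent inequality at the weighted mean `c`. The linear terms
on both sides average to `a + c` and cancel. -/
lemma klPoint_sum_le {ι : Type*} (s : Finset ι) (w b : ι → ℝ) {a : ℝ} (ha : 0 ≤ a)
    (hw : ∀ i ∈ s, 0 ≤ w i) (hw1 : ∑ i ∈ s, w i = 1) (hb : ∀ i ∈ s, 0 ≤ b i) :
    klPoint a (∑ i ∈ s, w i * b i) ≤ ∑ i ∈ s, ENNReal.ofReal (w i) * klPoint a (b i) := by
  have hnn : ∀ i ∈ s, 0 ≤ w i * b i := fun i hi => mul_nonneg (hw i hi) (hb i hi)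
  have hc0 := Finset.sum_nonneg hnn
  obtain ⟨c, hc⟩ : ∃ c, c = ∑ i ∈ s, w i * b i := ⟨_, rfl⟩
  rw [← hc] at hc0 ⊢
  -- There is no tangent at `c = 0`; for `a > 0` some `b i` of positive weight then vanishes and the
  -- right side is infinite.
  rcases hc0.eq_or_lt with h0 | h0
  · rcases ha.eq_or_lt with rfl | ha
    · simp [← h0, klPoint_zero_left]
    obtain ⟨i, hi, hwi⟩ : ∃ i ∈ s, w i ≠ 0 := Finset.exists_ne_zero_of_sum_ne_zero (by simp [hw1])
    have hbi : b i = 0 := by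
      have := (Finset.sum_eq_zero_iff_of_nonneg hnn).1 (hc.symm.trans h0.symm) i hi
      simpa [hwi] using this
    have : ENNReal.ofReal (w i) * klPoint a (b i) = ⊤ := by
      rw [hbi, klPoint_zero_right ha.ne', ENNReal.mul_top]
      simpa using lt_of_le_of_ne (hw i hi) hwi.symm
    exact le_top.trans (this.symm.le.trans
      (Finset.single_le_sum (f := fun i => ENNReal.ofReal (w i) * klPoint a (b i))
        (fun _ _ => zero_le) hi))
  · have key : klPoint a c + ENNReal.ofReal (a + c) ≤
        (∑ i ∈ s, ENNReal.ofReal (w i) * klPoint a (b i)) + ENNReal.ofReal (a + c) := by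
      have hsum : ∑ i ∈ s, ENNReal.ofReal (w i) = 1 := by
        rw [← ENNReal.ofReal_sum_of_nonneg hw, hw1, ENNReal.ofReal_one]
      have e1 : ∑ i ∈ s, ENNReal.ofReal (w i) * ENNReal.ofReal (a + b i) =
          ENNReal.ofReal (a + c) := by
        rw [Finset.sum_congr rfl fun i hi => (ENNReal.ofReal_mul (hw i hi)).symm,
          ← ENNReal.ofReal_sum_of_nonneg fun i hi =>
            mul_nonneg (hw i hi) (add_nonneg ha (hb i hi))]
        simp_rw [mul_add, Finset.sum_add_distrib, ← Finset.sum_mul, hw1, one_mul, hc]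
      have e2 : ∑ i ∈ s, ENNReal.ofReal (w i) * ENNReal.ofReal (a * b i / c + c) =
          ENNReal.ofReal (a + c) := by
        rw [Finset.sum_congr rfl fun i hi => (ENNReal.ofReal_mul (hw i hi)).symm,
          ← ENNReal.ofReal_sum_of_nonneg fun i hi => mul_nonneg (hw i hi)
            (add_nonneg (div_nonneg (mul_nonneg ha (hb i hi)) h0.le) h0.le)]
        congr 1
        have : ∀ i, w i * (a * b i / c + c) = a / c * (w i * b i) + w i * c := fun i => by ring
        simp_rw [this, Finset.sum_add_distrib, ← Finset.mul_sum, ← Finset.sum_mul, hw1, ← hc]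
        field_simp
      calc klPoint a c + ENNReal.ofReal (a + c)
          = ∑ i ∈ s, ENNReal.ofReal (w i) * (klPoint a c + ENNReal.ofReal (a + b i)) := by
            simp_rw [mul_add, Finset.sum_add_distrib, ← Finset.sum_mul, hsum, one_mul, e1]
        _ ≤ ∑ i ∈ s, ENNReal.ofReal (w i) *
              (klPoint a (b i) + ENNReal.ofReal (a * b i / c + c)) :=
            Finset.sum_le_sum fun i hi => 
              mul_le_mul_right (klPoint_tangent ha (hb i hi) h0) _
        _ = _ := by simp_rw [mul_add, Finset.sum_add_distrib, e2]
    exact (ENNReal.add_le_add_iff_right ENNReal.ofReal_ne_top).1 key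

end Convexity

/-! ### Upper bound: likelihood shares and weights. -/

section Upper

variable {X : Type*} {M n : ℕ} {fs : Fin M → X → ℝ}

/-- `-log w`, with values in `[0, ∞]`. -/
def negLog (w : ℝ) : ℝ≥0∞ := if w = 0 then ⊤ else ENNReal.ofReal (-Real.log w)

lemma measurable_negLog : Measurable negLog :=
  Measurable.ite (measurableSet_singleton 0) measurable_const (by fun_prop)

/-- For `a, b > 0` this is an equality, obtained by expanding the logarithms. The hypothesis `w * b
≤ c` makes `-log (w * b / c)` nonnegative, so `ENNReal.ofReal` does not truncate it. -/
lemma mul_negLog_add_klPoint_le {a b c w : ℝ} (ha : 0 ≤ a) (hb : 0 ≤ b)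
    (hw : 0 < w) (hw1 : w ≤ 1) (h : w * b ≤ c) :
    ENNReal.ofReal a * negLog (w * b / c) + klPoint a c + ENNReal.ofReal b ≤
      ENNReal.ofReal a * negLog w + klPoint a b + ENNReal.ofReal c := by
  rcases ha.eq_or_lt with rfl | ha
  · simp [klPoint_zero_left, add_comm]
  rcases hb.eq_or_lt with rfl | hb
  · simp [klPoint_zero_right ha.ne']
  have hwb : 0 < w * b := mul_pos hw hb
  have hc : 0 < c := hwb.trans_le h
  have hlogw : 0 ≤ -Real.log w := neg_nonneg.2 (Real.log_nonpos hw.le hw1)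
  have hlog : 0 ≤ -Real.log (w * b / c) :=
    neg_nonneg.2 (Real.log_nonpos (by positivity) ((div_le_one hc).2 h))
  have hac := mul_log_div_add_sub_nonneg ha.le hc
  have hab := mul_log_div_add_sub_nonneg ha.le hb
  rw [negLog, negLog, if_neg (by positivity), if_neg hw.ne', klPoint_of_ne_zero hb.ne',
    klPoint_of_ne_zero hc.ne', ← ENNReal.ofReal_mul ha.le, ← ENNReal.ofReal_mul ha.le,
    ← ENNReal.ofReal_add (by positivity) hac, ← ENNReal.ofReal_add (by positivity) hb.le,
    ← ENNReal.ofReal_add (by positivity) hab, ← ENNReal.ofReal_add (by positivity) hc.le]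
  refine ENNReal.ofReal_le_ofReal (le_of_eq ?_)
  rw [Real.log_div hwb.ne' hc.ne', Real.log_mul hw.ne' hb.ne', Real.log_div ha.ne' hc.ne',
    Real.log_div ha.ne' hb.ne']
  ring

lemma likelihood_nonneg {g : X → ℝ} (hg : ∀ y, 0 ≤ g y) (x : Fin n → X) (k : ℕ) :
    0 ≤ likelihood g x k := Finset.prod_nonneg fun _ _ => hg _

lemma likelihood_zero (g : X → ℝ) (x : Fin n → X) : likelihood g x 0 = 1 := by
  simp [likelihood]

lemma likelihood_update (g : X → ℝ) (x : Fin n → X) (i : Fin n) (y : X) {k : ℕ} (hk : k ≤ i) :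
    likelihood g (Function.update x i y) k = likelihood g x k := by
  refine Finset.prod_congr rfl fun l hl => ?_
  rw [Function.update_of_ne]
  rintro rfl
  exact absurd (Finset.mem_filter.1 hl).2 (not_lt.2 hk)

lemma likelihood_succ (g : X → ℝ) (x : Fin n → X) (i : Fin n) :
    likelihood g x (i + 1) = likelihood g x i * g (x i) := by
  have : Finset.univ.filter (fun l : Fin n => l.val < i + 1) =
      insert i (Finset.univ.filter fun l : Fin n => l.val < i) := by
    ext l
    simp only [Finset.mem_filter, Finset.mem_univ, true_and, Finset.mem_insert, Fin.ext_iff]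
    omega
  rw [likelihood, this, Finset.prod_insert (by simp), mul_comm]
  rfl

lemma weight_nonneg (hfs : ∀ j y, 0 ≤ fs j y) (x : Fin n → X) (k : ℕ) (j : Fin M) :
    0 ≤ weight fs x k j := by
  unfold weight
  split_ifs
  · positivity
  · exact div_nonneg (likelihood_nonneg (hfs j) x k)
      (Finset.sum_nonneg fun l _ => likelihood_nonneg (hfs l) x k)

lemma sum_weight (hM : M ≠ 0) (x : Fin n → X) (k : ℕ) : ∑ j, weight fs x k j = 1 := by
  by_cases h : ∑ l, likelihood (fs l) x k = 0
  · simp [weight, h, hM]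
  · simp [weight, h, ← Finset.sum_div]

/-- The mixture `∑_j w_j^{(k)} f_j`. -/
def exponentialMixture (fs : Fin M → X → ℝ) (x : Fin n → X) (k : ℕ) (y : X) : ℝ :=
  ∑ j, weight fs x k j * fs j y

lemma progressiveMixture_eq (x : Fin n → X) (y : X) :
    progressiveMixture M n fs x y =
      ∑ k ∈ Finset.range (n + 1), ((n : ℝ) + 1)⁻¹ * exponentialMixture fs x k y := by
  simp only [progressiveMixture, averagedWeight, exponentialMixture, Finset.mul_sum,
    Finset.sum_mul]
  rw [Finset.sum_comm]
  simp only [mul_assoc]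

lemma averagedWeight_nonneg (hfs : ∀ j y, 0 ≤ fs j y) (x : Fin n → X) (j : Fin M) :
    0 ≤ averagedWeight fs x j :=
  mul_nonneg (by positivity) (Finset.sum_nonneg fun k _ => weight_nonneg hfs x k j)

lemma sum_averagedWeight (hM : M ≠ 0) (x : Fin n → X) : ∑ j, averagedWeight fs x j = 1 := by
  simp only [averagedWeight, ← Finset.mul_sum]
  rw [Finset.sum_comm]
  simp only [sum_weight hM, Finset.sum_const, Finset.card_range]
  have : (n : ℝ) + 1 ≠ 0 := by positivity
  simp [this]

/-- Bayes' rule: the new normalization is the old one times the mixture at the new observation.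
Coordinate `i` is observation number `i + 1`, so the shares after `i` observations do not depend on
it. -/
lemma likelihood_share_succ (hfs : ∀ j y, 0 ≤ fs j y) (x : Fin n → X) (i : Fin n) (y : X) {j : Fin M}
    (hj : likelihood (fs j) x i ≠ 0) :
    likelihood (fs j) (Function.update x i y) (i + 1) /
        ∑ l, likelihood (fs l) (Function.update x i y) (i + 1) =
      likelihood (fs j) x i / (∑ l, likelihood (fs l) x i) * fs j y /
        exponentialMixture fs x i y := by
  have hS : ∑ l, likelihood (fs l) x i ≠ 0 := fun h => hj <|
    (Finset.sum_eq_zero_iff_of_nonneg fun l _ => likelihood_nonneg (hfs l) x i).1 h j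
      (Finset.mem_univ j)
  have hmix : ∑ l, likelihood (fs l) x i * fs l y =
      (∑ l, likelihood (fs l) x i) * exponentialMixture fs x i y := by
    simp only [exponentialMixture, weight, if_neg hS, Finset.mul_sum]
    refine Finset.sum_congr rfl fun l _ => ?_
    rw [← mul_assoc, mul_div_cancel₀ _ hS]
  simp only [likelihood_succ, likelihood_update _ x i y le_rfl, Function.update_self, hmix]
  rw [← div_div, div_mul_eq_mul_div]

/-- The regret potential: minus the logarithm of the share of `f_j` in the total likelihood of
the first `k` observations. -/
def potential (fs : Fin M → X → ℝ) (j : Fin M) (k : ℕ) (x : Fin n → X) : ℝ≥0∞ :=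
  negLog (likelihood (fs j) x k / ∑ l, likelihood (fs l) x k)

lemma potential_zero (j : Fin M) (x : Fin n → X) :
    potential fs j 0 x = ENNReal.ofReal (Real.log M) := by
  have hM : (M : ℝ) ≠ 0 := by
    have := j.pos
    positivity
  simp [potential, likelihood_zero, negLog, hM]

lemma likelihood_share_pos_and_le (hfs : ∀ j y, 0 ≤ fs j y) (x : Fin n → X) (k : ℕ) {j : Fin M}
    (hj : likelihood (fs j) x k ≠ 0) :
    0 < likelihood (fs j) x k / (∑ l, likelihood (fs l) x k) ∧
      likelihood (fs j) x k / (∑ l, likelihood (fs l) x k) ≤ 1 ∧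
      ∀ y, likelihood (fs j) x k / (∑ l, likelihood (fs l) x k) * fs j y ≤
        exponentialMixture fs x k y := by
  have hL : 0 < likelihood (fs j) x k := lt_of_le_of_ne (likelihood_nonneg (hfs j) x k) hj.symm
  have hle : likelihood (fs j) x k ≤ ∑ l, likelihood (fs l) x k :=
    Finset.single_le_sum (f := fun l => likelihood (fs l) x k)
      (fun l _ => likelihood_nonneg (hfs l) x k) (Finset.mem_univ j)
  have hS := hL.trans_le hle
  refine ⟨div_pos hL hS, (div_le_one hS).2 hle, fun y => ?_⟩
  have := Finset.single_le_sum (f := fun l => weight fs x k l * fs l y)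
      (fun l _ => mul_nonneg (weight_nonneg hfs x k l) (hfs l y)) (Finset.mem_univ j)
  simpa [exponentialMixture, weight, hS.ne'] using this

/-! ### Upper bound: risks of the mixtures. -/

variable [MeasurableSpace X] {ν : Measure X} {A : ℝ} {f : X → ℝ}

lemma isDensity_sum (hfs : ∀ j, IsDensity ν (fs j)) {w : Fin M → ℝ} (hw : ∀ j, 0 ≤ w j)
    (hw1 : ∑ j, w j = 1) : IsDensity ν fun y => ∑ j, w j * fs j y where
  measurable := Finset.measurable_fun_sum _ fun j _ => (hfs j).measurable.const_mul _
  nonneg y := Finset.sum_nonneg fun j _ => mul_nonneg (hw j) ((hfs j).nonneg y)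
  lintegral_eq_one := by
    have h : ∀ y, ENNReal.ofReal (∑ j, w j * fs j y) =
        ∑ j, ENNReal.ofReal (w j) * ENNReal.ofReal (fs j y) := fun y => by
      rw [ENNReal.ofReal_sum_of_nonneg fun j _ => mul_nonneg (hw j) ((hfs j).nonneg y)]
      exact Finset.sum_congr rfl fun j _ => ENNReal.ofReal_mul (hw j)
    simp_rw [h]
    rw [lintegral_finsetSum _ fun j _ => ((hfs j).measurable.ennreal_ofReal).const_mul _]
    rw [Finset.sum_congr rfl fun j _ => by
        rw [lintegral_const_mul _ (hfs j).measurable.ennreal_ofReal, (hfs j).lintegral_eq_one,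
          mul_one],
      ← ENNReal.ofReal_sum_of_nonneg fun j _ => hw j, hw1, ENNReal.ofReal_one]

lemma measurable_likelihood {g : X → ℝ} (hg : Measurable g) (k : ℕ) :
    Measurable fun x : Fin n → X => likelihood g x k :=
  Finset.measurable_fun_prod _ fun i _ => hg.comp (measurable_pi_apply i)

lemma measurable_weight (hfs : ∀ j, IsDensity ν (fs j)) (k : ℕ) (j : Fin M) :
    Measurable fun x : Fin n → X => weight fs x k j := by
  have h : ∀ l, Measurable fun x : Fin n → X => likelihood (fs l) x k := fun l =>
    measurable_likelihood (hfs l).measurable k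
  have hS : Measurable fun x : Fin n → X => ∑ l, likelihood (fs l) x k :=
    Finset.measurable_fun_sum _ fun l _ => h l
  exact Measurable.ite (hS (measurableSet_singleton 0)) measurable_const ((h j).div hS)

lemma isEstimator_exponentialMixture (hM : M ≠ 0) (hfs : ∀ j, IsDensity ν (fs j)) (k : ℕ) :
    IsEstimator ν n fun x => exponentialMixture fs x k where
  measurable := Finset.measurable_fun_sum _ fun j _ =>
    ((measurable_weight hfs k j).comp measurable_fst).mul
      ((hfs j).measurable.comp measurable_snd)
  isDensity x := isDensity_sum hfs (weight_nonneg (fun j => (hfs j).nonneg) x k)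
    (sum_weight hM x k)

lemma isEstimator_progressiveMixture (hM : M ≠ 0) (hfs : ∀ j, IsDensity ν (fs j)) :
    IsEstimator ν n (progressiveMixture M n fs) where
  measurable := Finset.measurable_fun_sum _ fun j _ =>
    (((Finset.measurable_fun_sum _ fun k _ =>
      measurable_weight hfs k j).const_mul _).comp measurable_fst).mul
        ((hfs j).measurable.comp measurable_snd)
  isDensity x := isDensity_sum hfs (averagedWeight_nonneg (fun j => (hfs j).nonneg) x)
    (sum_averagedWeight hM x)

lemma progressiveMixture_mem (hM : M ≠ 0) (hfs : ∀ j, fs j ∈ densitiesBoundedBy ν A)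
    (x : Fin n → X) : progressiveMixture M n fs x ∈ densitiesBoundedBy ν A := by
  refine ⟨(isEstimator_progressiveMixture hM fun j => (hfs j).1).isDensity x, fun y => ?_⟩
  calc ∑ j, averagedWeight fs x j * fs j y ≤ ∑ j, averagedWeight fs x j * A :=
        Finset.sum_le_sum fun j _ => mul_le_mul_of_nonneg_left ((hfs j).2 y)
          (averagedWeight_nonneg (fun j => (hfs j).1.nonneg) x j)
    _ = A := by rw [← Finset.sum_mul, sum_averagedWeight hM, one_mul]

lemma klLoss_progressiveMixture_le (hM : M ≠ 0) (hf : IsDensity ν f)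
    (hfs : ∀ j, IsDensity ν (fs j)) (x : Fin n → X) :
    klLoss ν f (progressiveMixture M n fs x) ≤ ∑ k ∈ Finset.range (n + 1),
      ENNReal.ofReal ((n : ℝ) + 1)⁻¹ * klLoss ν f (exponentialMixture fs x k) := by
  have hd := fun k => (isEstimator_exponentialMixture (n := n) hM hfs k).isDensity x
  have hm : ∀ k, Measurable fun y => klPoint (f y) (exponentialMixture fs x k y) := fun k =>
    measurable_klPoint.comp (hf.measurable.prodMk (hd k).measurable)
  rw [hf.klLoss_eq_lintegral ((isEstimator_progressiveMixture hM hfs).isDensity x)]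
  rw [Finset.sum_congr rfl fun k _ => by
      rw [hf.klLoss_eq_lintegral (hd k), ← lintegral_const_mul _ (hm k)],
    ← lintegral_finsetSum _ fun k _ => (hm k).const_mul _]
  refine lintegral_mono fun y => ?_
  rw [progressiveMixture_eq]
  refine klPoint_sum_le _ _ _ (hf.nonneg y) (fun _ _ => by positivity) ?_
    fun k _ => (hd k).nonneg y
  have : (n : ℝ) + 1 ≠ 0 := by positivity
  simp [this]

lemma measurable_potential (hfs : ∀ j, IsDensity ν (fs j)) (j : Fin M) (k : ℕ) :
    Measurable (potential (n := n) fs j k) :=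
  measurable_negLog.comp ((measurable_likelihood (hfs j).measurable k).div
    (Finset.measurable_fun_sum _ fun l _ => measurable_likelihood (hfs l).measurable k))

/-- One step of the telescoping, with the new observation integrated out. -/
lemma lintegral_potential_update_add_klLoss_le (hf : IsDensity ν f)
    (hfs : ∀ j, IsDensity ν (fs j)) (x : Fin n → X) (i : Fin n) (j : Fin M) :
    ∫⁻ y, potential fs j (i + 1) (Function.update x i y) ∂(law ν f) +
        klLoss ν f (exponentialMixture fs x i) ≤
      potential fs j i x + klLoss ν f (fs j) := by
  have hnn := fun j => (hfs j).nonneg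
  by_cases hj : likelihood (fs j) x i = 0
  -- The potential uses the raw share, not `weight`, so it is infinite here and the bound is
  -- trivial.
  · simp [potential, hj, negLog]
  obtain ⟨hw, hw1, hle⟩ := likelihood_share_pos_and_le hnn x i hj
  have hd := (isEstimator_exponentialMixture (n := n) (Nat.ne_of_gt j.pos) hfs i).isDensity x
  have hp : Measurable fun y => potential fs j (i + 1) (Function.update x i y) :=
    (measurable_potential hfs j _).comp (measurable_update x)
  have hm : ∀ {g}, IsDensity ν g → Measurable fun y => klPoint (f y) (g y) := fun hg =>
    measurable_klPoint.comp (hf.measurable.prodMk hg.measurable)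
  have hfm := hf.measurable.ennreal_ofReal
  have key : ∫⁻ y, (ENNReal.ofReal (f y) * potential fs j (i + 1) (Function.update x i y) +
        klPoint (f y) (exponentialMixture fs x i y) + ENNReal.ofReal (fs j y)) ∂ν ≤
      ∫⁻ y, (ENNReal.ofReal (f y) * potential fs j i x + klPoint (f y) (fs j y) +
        ENNReal.ofReal (exponentialMixture fs x i y)) ∂ν := by
    refine lintegral_mono fun y => ?_
    simp only [potential, likelihood_share_succ hnn x i y hj]
    exact mul_negLog_add_klPoint_le (hf.nonneg y) (hnn j y) hw hw1 (hle y)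
  -- The extra terms `fs j` and the mixture both integrate to one and cancel.
  rw [lintegral_add_right _ (hfs j).measurable.ennreal_ofReal,
    lintegral_add_right _ hd.measurable.ennreal_ofReal, lintegral_add_right _ (hm hd),
    lintegral_add_right _ (hm (hfs j)), lintegral_mul_const _ hfm, hf.lintegral_eq_one, one_mul,
    (hfs j).lintegral_eq_one, hd.lintegral_eq_one,
    ENNReal.add_le_add_iff_right ENNReal.one_ne_top, ← hf.lintegral_law hp,
    ← hf.klLoss_eq_lintegral hd, ← hf.klLoss_eq_lintegral (hfs j)] at key
  exact key

/-- Follows from `w f_j ≤ m`. It serves the mixture built on all `n` observations, which has no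
further observation to telescope with. -/
lemma klLoss_exponentialMixture_le (hf : IsDensity ν f)
    (hfs : ∀ j, IsDensity ν (fs j)) (x : Fin n → X) (k : ℕ) (j : Fin M) :
    klLoss ν f (exponentialMixture fs x k) ≤ potential fs j k x + klLoss ν f (fs j) := by
  have hnn := fun j => (hfs j).nonneg
  by_cases hj : likelihood (fs j) x k = 0
  · simp [potential, hj, negLog]
  obtain ⟨hw, hw1, hle⟩ := likelihood_share_pos_and_le hnn x k hj
  have hd := (isEstimator_exponentialMixture (n := n) (Nat.ne_of_gt j.pos) hfs k).isDensity x
  have hm : ∀ {g}, IsDensity ν g → Measurable fun y => klPoint (f y) (g y) := fun hg =>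
    measurable_klPoint.comp (hf.measurable.prodMk hg.measurable)
  have key : ∫⁻ y, (klPoint (f y) (exponentialMixture fs x k y) + ENNReal.ofReal (fs j y)) ∂ν ≤
      ∫⁻ y, (ENNReal.ofReal (f y) * potential fs j k x + klPoint (f y) (fs j y) +
        ENNReal.ofReal (exponentialMixture fs x k y)) ∂ν := by
    refine lintegral_mono fun y => ?_
    refine le_trans ?_
      (mul_negLog_add_klPoint_le (hf.nonneg y) (hnn j y) hw hw1 (hle y))
    rw [add_assoc]
    exact le_add_self
  rw [lintegral_add_right _ (hfs j).measurable.ennreal_ofReal,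
    lintegral_add_right _ hd.measurable.ennreal_ofReal, lintegral_add_right _ (hm (hfs j)),
    lintegral_mul_const _ hf.measurable.ennreal_ofReal, hf.lintegral_eq_one, one_mul,
    (hfs j).lintegral_eq_one, hd.lintegral_eq_one,
    ENNReal.add_le_add_iff_right ENNReal.one_ne_top,
    ← hf.klLoss_eq_lintegral hd, ← hf.klLoss_eq_lintegral (hfs j)] at key
  exact key

/-- Resampling one coordinate independently preserves the product law: both integrands have the same
marginal over that coordinate. -/
lemma lintegral_pi_eq_lintegral_lintegral_update (μ : Measure X) [IsProbabilityMeasure μ]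
    {F : (Fin n → X) → ℝ≥0∞} (hF : Measurable F) (i : Fin n) :
    ∫⁻ x, F x ∂Measure.pi (fun _ => μ) =
      ∫⁻ x, ∫⁻ y, F (Function.update x i y) ∂μ ∂Measure.pi (fun _ => μ) := by
  have hG : Measurable fun x => ∫⁻ y, F (Function.update x i y) ∂μ := by
    have := hF.lmarginal (fun _ => μ) (s := {i})
    rwa [lmarginal_singleton] at this
  refine lintegral_eq_of_lmarginal_eq {i} hF hG ?_
  rw [lmarginal_singleton, lmarginal_singleton]
  ext x
  simp

lemma lintegral_potential_add_sum_le [SFinite ν] (hf : IsDensity ν f)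
    (hfs : ∀ j, IsDensity ν (fs j)) (j : Fin M) {k : ℕ} (hk : k ≤ n) :
    ∫⁻ x, potential fs j k x ∂Measure.pi (fun _ : Fin n => law ν f) +
        ∑ i ∈ Finset.range k, klRisk (n := n) ν (fun x => exponentialMixture fs x i) f ≤
      ENNReal.ofReal (Real.log M) + k * klLoss ν f (fs j) := by
  have := hf.isProbabilityMeasure_law
  induction k with
  | zero => simp [potential_zero]
  | succ k ih =>
    have hm := (isEstimator_exponentialMixture (n := n) (Nat.ne_of_gt j.pos) hfs
      k).measurable_klLoss hf
    have step : ∫⁻ x, potential fs j (k + 1) x ∂Measure.pi (fun _ : Fin n => law ν f) +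
        klRisk (n := n) ν (fun x => exponentialMixture fs x k) f ≤
        ∫⁻ x, potential fs j k x ∂Measure.pi (fun _ : Fin n => law ν f) +
          klLoss ν f (fs j) := by
      rw [lintegral_pi_eq_lintegral_lintegral_update (law ν f) (measurable_potential hfs j _)
        ⟨k, hk⟩, klRisk, ← lintegral_add_right _ hm]
      refine (lintegral_mono fun x => lintegral_potential_update_add_klLoss_le hf hfs x ⟨k, hk⟩
        j).trans ?_
      rw [lintegral_add_right _ measurable_const]
      simp
    rw [Finset.sum_range_succ, add_comm (Finset.sum _ _), ← add_assoc]
    calc _ ≤ _ := add_le_add_left step _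
      _ = (∫⁻ x, potential fs j k x ∂Measure.pi (fun _ : Fin n => law ν f) +
          ∑ i ∈ Finset.range k, klRisk (n := n) ν (fun x => exponentialMixture fs x i) f) +
            klLoss ν f (fs j) := add_right_comm _ _ _
      _ ≤ _ := add_le_add_left (ih (by omega)) _
      _ = _ := by push_cast; ring

theorem klRisk_progressiveMixture_le [SFinite ν] (hf : IsDensity ν f)
    (hfs : ∀ j, IsDensity ν (fs j)) (j : Fin M) :
    klRisk ν (progressiveMixture M n fs) f ≤
      ENNReal.ofReal (((n : ℝ) + 1)⁻¹ * Real.log M) + klLoss ν f (fs j) := by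
  have := hf.isProbabilityMeasure_law
  have hM := Nat.ne_of_gt j.pos
  have hm := fun k => (isEstimator_exponentialMixture (n := n) hM hfs k).measurable_klLoss hf
  have hpos : (0 : ℝ) < (n : ℝ) + 1 := by positivity
  have hlast : klRisk (n := n) ν (fun x => exponentialMixture fs x n) f ≤
      ∫⁻ x, potential fs j n x ∂Measure.pi (fun _ : Fin n => law ν f) + klLoss ν f (fs j) := by
    refine (lintegral_mono fun x => klLoss_exponentialMixture_le hf hfs x n j).trans ?_
    rw [lintegral_add_right _ measurable_const]
    simp
  have hsum : ∑ i ∈ Finset.range (n + 1),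
      klRisk (n := n) ν (fun x => exponentialMixture fs x i) f ≤
        ENNReal.ofReal (Real.log M) + ENNReal.ofReal ((n : ℝ) + 1) * klLoss ν f (fs j) := by
    rw [Finset.sum_range_succ, add_comm]
    calc _ ≤ _ := add_le_add_left hlast _
      _ = (∫⁻ x, potential fs j n x ∂Measure.pi (fun _ : Fin n => law ν f) +
          ∑ i ∈ Finset.range n, klRisk (n := n) ν (fun x => exponentialMixture fs x i) f) +
            klLoss ν f (fs j) := add_right_comm _ _ _
      _ ≤ _ := add_le_add_left (lintegral_potential_add_sum_le hf hfs j le_rfl) _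
      _ = _ := by
        rw [ENNReal.ofReal_add (by positivity) zero_le_one, ENNReal.ofReal_natCast,
          ENNReal.ofReal_one]
        ring
  calc klRisk ν (progressiveMixture M n fs) f
      ≤ ∫⁻ x, ∑ k ∈ Finset.range (n + 1), ENNReal.ofReal ((n : ℝ) + 1)⁻¹ *
          klLoss ν f (exponentialMixture fs x k) ∂Measure.pi (fun _ : Fin n => law ν f) :=
        lintegral_mono fun x => klLoss_progressiveMixture_le hM hf hfs x
    _ = ENNReal.ofReal ((n : ℝ) + 1)⁻¹ * ∑ i ∈ Finset.range (n + 1),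
          klRisk (n := n) ν (fun x => exponentialMixture fs x i) f := by
        rw [lintegral_finsetSum _ fun k _ => (hm k).const_mul _, Finset.mul_sum]
        exact Finset.sum_congr rfl fun k _ => lintegral_const_mul _ (hm k)
    _ ≤ ENNReal.ofReal ((n : ℝ) + 1)⁻¹ * (ENNReal.ofReal (Real.log M) +
          ENNReal.ofReal ((n : ℝ) + 1) * klLoss ν f (fs j)) := by gcongr
    _ = _ := by
        rw [mul_add, ← mul_assoc, ← ENNReal.ofReal_mul (by positivity),
          ← ENNReal.ofReal_mul (by positivity), inv_mul_cancel₀ hpos.ne', ENNReal.ofReal_one,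
          one_mul]

theorem attainsUpperBound_progressiveMixture [SFinite ν] (hM : 2 ≤ M) (hn : 1 ≤ n)
    (hfs : ∀ j, fs j ∈ densitiesBoundedBy ν A) :
    AttainsUpperBound ν (densitiesBoundedBy ν A) (densitiesBoundedBy ν A) fs
      (progressiveMixture M n fs) (Real.log M / n) := by
  have hM0 : M ≠ 0 := by omega
  have hd := fun j => (hfs j).1
  refine ⟨isEstimator_progressiveMixture hM0 hd, progressiveMixture_mem hM0 hfs,
    iSup₂_le fun f hf => EReal.sub_le_of_le_add ?_⟩
  have hlog : 0 ≤ Real.log M := Real.log_natCast_nonneg M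
  have hr : ((n : ℝ) + 1)⁻¹ * Real.log M ≤ Real.log M / n := by
    have : (0 : ℝ) < n := by exact_mod_cast hn
    rw [inv_mul_eq_div]
    gcongr
    linarith
  have h : klRisk ν (progressiveMixture M n fs) f ≤
      ENNReal.ofReal (Real.log M / n) + ⨅ j, klLoss ν f (fs j) := by
    have : Nonempty (Fin M) := ⟨⟨0, by omega⟩⟩
    rw [ENNReal.add_iInf]
    exact le_iInf fun j => (klRisk_progressiveMixture_le hf.1 hd j).trans (by gcongr)
  have h' := EReal.coe_ennreal_le_coe_ennreal_iff.2 h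
  rwa [EReal.coe_ennreal_add, EReal.coe_ennreal_ofReal, max_eq_left (by positivity)] at h'

end Upper

/-! ### Lower bound: densities with a hidden needle. -/

section Lower

variable {X : Type*} {B : ℕ → Set X} {δ : ℝ} {M n : ℕ}

/-- The density that is `1 - δ` on `B 0` and `δ` on `B (j + 1)`. -/
def needleDensity (B : ℕ → Set X) (δ : ℝ) (j : ℕ) (x : X) : ℝ :=
  (B 0).indicator (fun _ => 1 - δ) x + (B (j + 1)).indicator (fun _ => δ) x

lemma needleDensity_of_mem_zero (hd : Pairwise (Function.onFun Disjoint B)) (j : ℕ) {x : X}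
    (hx : x ∈ B 0) : needleDensity B δ j x = 1 - δ := by
  have : x ∉ B (j + 1) := fun h => (hd (by omega : 0 ≠ j + 1)).notMem_of_mem_left hx h
  simp [needleDensity, hx, this]

lemma needleDensity_of_mem_succ (hd : Pairwise (Function.onFun Disjoint B)) (i j : ℕ) {x : X}
    (hx : x ∈ B (j + 1)) : needleDensity B δ i x = if i = j then δ else 0 := by
  have h0 : x ∉ B 0 := fun h => (hd (by omega : 0 ≠ j + 1)).notMem_of_mem_left h hx
  split_ifs with h
  · simp [needleDensity, h, hx, h0]
  · have : x ∉ B (i + 1) := fun h' => (hd (by omega : i + 1 ≠ j + 1)).notMem_of_mem_left h' hx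
    simp [needleDensity, this, h0]

lemma needleDensity_le_one (hd : Pairwise (Function.onFun Disjoint B)) (h0 : 0 ≤ δ) (h1 : δ ≤ 1)
    (j : ℕ) (x : X) : needleDensity B δ j x ≤ 1 := by
  by_cases hx : x ∈ B 0
  · rw [needleDensity_of_mem_zero hd j hx]
    linarith
  · by_cases hx' : x ∈ B (j + 1) <;> simp [needleDensity, hx, hx', h1]

variable [MeasurableSpace X] {ν : Measure X} {A : ℝ}

lemma isDensity_needleDensity (hB : ∀ k, MeasurableSet (B k)) (hν : ∀ k, ν (B k) = 1)
    (h0 : 0 ≤ δ) (h1 : δ ≤ 1) (j : ℕ) : IsDensity ν (needleDensity B δ j) where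
  measurable := (measurable_const.indicator (hB 0)).add (measurable_const.indicator (hB _))
  nonneg x := add_nonneg (Set.indicator_nonneg (fun _ _ => sub_nonneg.2 h1) x)
    (Set.indicator_nonneg (fun _ _ => h0) x)
  lintegral_eq_one := by
    have h : ∀ x, ENNReal.ofReal (needleDensity B δ j x) =
        (B 0).indicator (fun _ => ENNReal.ofReal (1 - δ)) x +
          (B (j + 1)).indicator (fun _ => ENNReal.ofReal δ) x := fun x => by
      rw [needleDensity, ENNReal.ofReal_add (Set.indicator_nonneg (fun _ _ => sub_nonneg.2 h1) x)
        (Set.indicator_nonneg (fun _ _ => h0) x)]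
      by_cases hx : x ∈ B 0 <;> by_cases hx' : x ∈ B (j + 1) <;> simp [hx, hx']
    simp_rw [h]
    rw [lintegral_add_left (measurable_const.indicator (hB 0)), lintegral_indicator_const (hB _),
      lintegral_indicator_const (hB _), hν, hν, mul_one, mul_one,
      ← ENNReal.ofReal_add (sub_nonneg.2 h1) h0]
    simp

/-- The right side is free of `j`: observations in `B 0` do not distinguish the candidates. -/
lemma law_restrict_needleDensity (hB : ∀ k, MeasurableSet (B k))
    (hd : Pairwise (Function.onFun Disjoint B)) (j : ℕ) :
    (law ν (needleDensity B δ j)).restrict (B 0) =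
      ENNReal.ofReal (1 - δ) • ν.restrict (B 0) := by
  rw [law, restrict_withDensity (hB 0), ← withDensity_const]
  refine withDensity_congr_ae ((ae_restrict_iff' (hB 0)).2 (ae_of_all _ fun x hx => ?_))
  simp only [needleDensity_of_mem_zero hd j hx]

/-- The `M - 1` candidates vanishing at the point cost `b` each, which completes `b` to `M * b`;
then use nonnegativity of the integrand at `(δ, M * b)`. -/
lemma ofReal_mul_log_le_sum_klPoint (hM : M ≠ 0) (hδ : 0 < δ) {b : ℝ} (hb : 0 ≤ b) (j : Fin M) :
    ENNReal.ofReal (δ * Real.log M) ≤ ∑ i : Fin M, klPoint (if i = j then δ else 0) b := by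
  have hM' : (0 : ℝ) < M := by positivity
  have hsum : ∑ i : Fin M, klPoint (if i = j then δ else 0) b =
      klPoint δ b + (M - 1 : ℕ) * ENNReal.ofReal b := by
    rw [← Finset.add_sum_erase _ _ (Finset.mem_univ j), if_pos rfl,
      Finset.sum_congr rfl fun i hi => by
        rw [if_neg (Finset.ne_of_mem_erase hi), klPoint_zero_left]]
    simp
  rw [hsum]
  rcases hb.eq_or_lt with rfl | hb
  · simp [klPoint_zero_right hδ.ne']
  rw [klPoint_of_ne_zero hb.ne', ← ENNReal.ofReal_natCast, ← ENNReal.ofReal_mul (by positivity),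
    ← ENNReal.ofReal_add (mul_log_div_add_sub_nonneg hδ.le hb) (by positivity),
    Nat.cast_sub (by omega), Nat.cast_one]
  refine ENNReal.ofReal_le_ofReal ?_
  have h := mul_log_div_add_sub_nonneg hδ.le (mul_pos hM' hb)
  have : Real.log (δ / (M * b)) = Real.log (δ / b) - Real.log M := by
    rw [Real.log_div hδ.ne' (by positivity), Real.log_mul hM'.ne' hb.ne',
      Real.log_div hδ.ne' hb.ne']
    ring
  rw [this] at h
  linarith

/-- Integrate the pointwise bound over the `M` needle sets, each of measure one, and discard the
rest of the space. -/
lemma ofReal_mul_log_le_sum_klLoss (hB : ∀ k, MeasurableSet (B k)) (hν : ∀ k, ν (B k) = 1)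
    (hd : Pairwise (Function.onFun Disjoint B)) (hM : M ≠ 0) (h0 : 0 < δ) (h1 : δ ≤ 1) {g : X → ℝ}
    (hg : IsDensity ν g) :
    M * ENNReal.ofReal (δ * Real.log M) ≤
      ∑ i : Fin M, klLoss ν (needleDensity B δ i) g := by
  have hf := fun j : ℕ => isDensity_needleDensity hB hν h0.le h1 j
  simp_rw [fun i : Fin M => (hf i).klLoss_eq_lintegral hg]
  have hm : ∀ i : Fin M, Measurable fun x => klPoint (needleDensity B δ i x) (g x) := fun i =>
    measurable_klPoint.comp ((hf i).measurable.prodMk hg.measurable)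
  rw [← lintegral_finsetSum _ fun i _ => hm i]
  calc (M : ℝ≥0∞) * ENNReal.ofReal (δ * Real.log M)
      = ∫⁻ x, ∑ j : Fin M,
          (B (j + 1)).indicator (fun _ => ENNReal.ofReal (δ * Real.log M)) x ∂ν := by
        rw [lintegral_finsetSum _ fun j _ => measurable_const.indicator (hB _)]
        simp [lintegral_indicator_const (hB _), hν]
    _ ≤ _ := by
        refine lintegral_mono fun x => ?_
        by_cases hx : ∃ j : Fin M, x ∈ B (j + 1)
        · obtain ⟨j, hj⟩ := hx
          rw [Finset.sum_eq_single j (fun i _ hij => Set.indicator_of_notMem (fun hi =>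
            (hd (by simpa [Fin.ext_iff] using hij : (i : ℕ) + 1 ≠ j + 1)).notMem_of_mem_left
              hi hj) _) (by simp), Set.indicator_of_mem hj]
          simp only [needleDensity_of_mem_succ hd _ _ hj, Fin.val_inj]
          exact ofReal_mul_log_le_sum_klPoint hM h0 (hg.nonneg x) j
        · push Not at hx
          simp [Set.indicator_of_notMem (hx _)]

lemma ofReal_le_sum_klRisk [SigmaFinite ν] (hB : ∀ k, MeasurableSet (B k)) (hν : ∀ k, ν (B k) = 1)
    (hd : Pairwise (Function.onFun Disjoint B)) (hM : M ≠ 0) (h0 : 0 < δ) (h1 : δ ≤ 1)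
    {fhat : (Fin n → X) → X → ℝ} (hfhat : IsEstimator ν n fhat) :
    M * ENNReal.ofReal ((1 - δ) ^ n * (δ * Real.log M)) ≤
      ∑ i : Fin M, klRisk ν fhat (needleDensity B δ i) := by
  have hf := fun j : ℕ => isDensity_needleDensity hB hν h0.le h1 j
  have hp := fun j : ℕ => (hf j).isProbabilityMeasure_law
  have hfin : IsFiniteMeasure (ENNReal.ofReal (1 - δ) • ν.restrict (B 0)) :=
    ⟨by simp [hν, ENNReal.ofReal_lt_top]⟩
  -- `κ` is the part of the sample law carried by samples inside `B 0`. It lies below all `M`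
  -- product laws, so their risks can be summed under one measure.
  obtain ⟨κ, hκ⟩ : ∃ κ : Measure (Fin n → X), κ =
    Measure.pi fun _ => ENNReal.ofReal (1 - δ) • ν.restrict (B 0) := ⟨_, rfl⟩
  have hle : ∀ i : ℕ, κ ≤ Measure.pi fun _ : Fin n => law ν (needleDensity B δ i) := fun i => by
    rw [hκ, ← law_restrict_needleDensity hB hd i, ← Measure.restrict_pi_pi]
    exact Measure.restrict_le_self
  have hmass : κ Set.univ = ENNReal.ofReal ((1 - δ) ^ n) := by
    rw [hκ, Measure.pi_univ]
    simp [hν, ENNReal.ofReal_pow (sub_nonneg.2 h1)]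
  calc M * ENNReal.ofReal ((1 - δ) ^ n * (δ * Real.log M))
      = ∫⁻ _, M * ENNReal.ofReal (δ * Real.log M) ∂κ := by
        rw [lintegral_const, hmass, ENNReal.ofReal_mul (pow_nonneg (sub_nonneg.2 h1) n)]
        ring
    _ ≤ ∫⁻ x, ∑ i : Fin M, klLoss ν (needleDensity B δ i) (fhat x) ∂κ :=
        lintegral_mono fun x =>
          ofReal_mul_log_le_sum_klLoss hB hν hd hM h0 h1 (hfhat.isDensity x)
    _ = ∑ i : Fin M, ∫⁻ x, klLoss ν (needleDensity B δ i) (fhat x) ∂κ :=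
        lintegral_finsetSum _ fun i _ => hfhat.measurable_klLoss (hf i)
    _ ≤ _ := Finset.sum_le_sum fun i _ => lintegral_mono' (hle i) le_rfl

/-- The right side is `(1 + 1 / n) ^ (-n) ≥ 1 / e`, and `e ≤ 4`. -/
lemma one_fourth_le_pow {n : ℕ} (hn : 1 ≤ n) : (1 / 4 : ℝ) ≤ (1 - ((n : ℝ) + 1)⁻¹) ^ n := by
  have hn' : (0 : ℝ) < n := by exact_mod_cast hn
  have h : 1 - ((n : ℝ) + 1)⁻¹ = (1 + (n : ℝ)⁻¹)⁻¹ := by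
    field_simp
    ring
  have h1 : (1 + (n : ℝ)⁻¹) ^ n ≤ 4 := by
    calc (1 + (n : ℝ)⁻¹) ^ n ≤ Real.exp (n : ℝ)⁻¹ ^ n := by
          gcongr
          linarith [Real.add_one_le_exp (n : ℝ)⁻¹]
      _ = Real.exp 1 := by rw [← Real.exp_nat_mul, mul_inv_cancel₀ hn'.ne']
      _ ≤ 4 := by linarith [Real.exp_one_lt_d9]
  rw [h, inv_pow, one_div]
  exact inv_anti₀ (by positivity) h1

theorem lowerBound_of_disjoint [SigmaFinite ν] (hB : ∀ k, MeasurableSet (B k))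
    (hν : ∀ k, ν (B k) = 1) (hd : Pairwise (Function.onFun Disjoint B)) (hA : 1 ≤ A)
    (range : ℕ → ℕ → Prop) :
    LowerBound ν (densitiesBoundedBy ν A) (densitiesBoundedBy ν A) range
      (fun M n => Real.log M / n) (1 / 8) := by
  intro M n hM hn _
  have hn' : (1 : ℝ) ≤ n := by exact_mod_cast hn
  -- This value maximizes `δ * (1 - δ) ^ n`.
  obtain ⟨δ, hδ⟩ : ∃ δ : ℝ, δ = ((n : ℝ) + 1)⁻¹ := ⟨_, rfl⟩
  have h0 : 0 < δ := by rw [hδ]; positivity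
  have h1 : δ ≤ 1 := by rw [hδ]; exact inv_le_one_of_one_le₀ (by linarith)
  have hmem : ∀ j : ℕ, needleDensity B δ j ∈ densitiesBoundedBy ν A := fun j =>
    ⟨isDensity_needleDensity hB hν h0.le h1 j,
      fun x => (needleDensity_le_one hd h0.le h1 j x).trans hA⟩
  refine ⟨fun j => needleDensity B δ j, fun j => hmem j, fun fhat hfhat => ?_⟩
  have hM0 : M ≠ 0 := by omega
  have : Nonempty (Fin M) := ⟨⟨0, by omega⟩⟩
  have hlog : 0 ≤ Real.log M := Real.log_natCast_nonneg M
  -- Some risk is at least the average risk.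
  obtain ⟨j, hj⟩ : ∃ j : Fin M,
      ENNReal.ofReal ((1 - δ) ^ n * (δ * Real.log M)) ≤
        klRisk ν fhat (needleDensity B δ j) := by
    by_contra! hlt
    refine (ofReal_le_sum_klRisk hB hν hd hM0 h0 h1 hfhat).not_gt ?_
    simpa using ENNReal.sum_lt_sum_of_nonempty Finset.univ_nonempty fun j _ => hlt j
  -- The constant is `1 / 4` from `(1 - δ) ^ n` times `1 / 2` from `n + 1 ≤ 2 * n`.
  have hbound : 1 / 8 * (Real.log M / n) ≤ (1 - δ) ^ n * (δ * Real.log M) := by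
    have hδn : 1 / (2 * (n : ℝ)) ≤ δ := by
      rw [hδ, one_div]
      exact inv_anti₀ (by positivity) (by linarith)
    calc 1 / 8 * (Real.log M / n) = 1 / 4 * (1 / (2 * n) * Real.log M) := by
          ring
      _ ≤ _ := by
          gcongr
          rw [hδ]
          exact one_fourth_le_pow hn
  -- The true density is itself one of the candidates, so its excess risk is its whole risk.
  have hmin : ⨅ i : Fin M, klLoss ν (needleDensity B δ j) (needleDensity B δ i) = 0 :=
    le_antisymm ((iInf_le _ j).trans (klLoss_self (hmem j).1).le) zero_le
  refine le_iSup₂_of_le (needleDensity B δ j) (hmem j) ?_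
  rw [excessRisk, hmin, EReal.coe_ennreal_zero, sub_zero]
  refine le_trans ?_ (EReal.coe_ennreal_le_coe_ennreal_iff.2 hj)
  rw [EReal.coe_ennreal_ofReal]
  exact EReal.coe_le_coe_iff.2 (hbound.trans (le_max_left _ _))

/-! ### Disjoint sets of unit volume in every dimension. -/

/-- The unit cube with lower corner `(k, …, k)`. -/
def diagonalCube (d k : ℕ) : Set (Fin d → ℝ) := Set.univ.pi fun _ => Set.Ico (k : ℝ) (k + 1)

lemma measurableSet_diagonalCube (d k : ℕ) : MeasurableSet (diagonalCube d k) :=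
  MeasurableSet.univ_pi fun _ => measurableSet_Ico

lemma volume_diagonalCube (d k : ℕ) : volume (diagonalCube d k) = 1 := by
  simp [diagonalCube, volume_pi_pi]

/-- The first coordinate separates the cubes; in dimension zero they would all coincide. -/
lemma pairwise_disjoint_diagonalCube {d : ℕ} (hd : 1 ≤ d) :
    Pairwise (Function.onFun Disjoint (diagonalCube d)) := by
  intro k l hkl
  refine Set.disjoint_left.2 fun x hk hl => hkl ?_
  have h1 := hk ⟨0, hd⟩ trivial
  have h2 := hl ⟨0, hd⟩ trivial
  have h3 : (k : ℝ) < l + 1 := h1.1.trans_lt h2.2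
  have h4 : (l : ℝ) < k + 1 := h2.1.trans_lt h1.2
  norm_cast at h3 h4
  omega

end Lower

end

end DensityAggregation

theorem mainTheorem1 (A : ℝ) (hA : 1 < A) :
    ∃ C c : ℝ, 0 < C ∧ 0 < c ∧ ∀ d : ℕ, 1 ≤ d →
      DensityAggregation.IsOptimalRate
        (volume : Measure (Fin d → ℝ))
        (DensityAggregation.densitiesBoundedBy volume A)
        (DensityAggregation.densitiesBoundedBy volume A)
        (fun M n => Real.log M ≤ 16 * (min 1 (A - 1)) ^ 2 * n)
        (fun M n => Real.log M / n) C c ∧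
      DensityAggregation.IsOptimalProcedure
        (volume : Measure (Fin d → ℝ))
        (DensityAggregation.densitiesBoundedBy volume A)
        (DensityAggregation.densitiesBoundedBy volume A)
        (fun M n => Real.log M ≤ 16 * (min 1 (A - 1)) ^ 2 * n)
        (fun M n => Real.log M / n) C c
        DensityAggregation.progressiveMixture := by
  refine ⟨1, 1 / 8, one_pos, by norm_num, fun d hd => ?_⟩
  have hlow := DensityAggregation.lowerBound_of_disjoint
    (DensityAggregation.measurableSet_diagonalCube d) (DensityAggregation.volume_diagonalCube d)
    (DensityAggregation.pairwise_disjoint_diagonalCube hd) hA.le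
    (fun M n => Real.log M ≤ 16 * (min 1 (A - 1)) ^ 2 * n)
  refine ⟨⟨fun M hM fs hfs => ⟨fun n => DensityAggregation.progressiveMixture M n fs,
    fun n hn _ => ?_⟩, hlow⟩, fun M hM fs hfs n hn _ => ?_, hlow⟩ <;>
  · rw [one_mul]
    exact DensityAggregation.attainsUpperBound_progressiveMixture hM hn hfs
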